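/- All graphs are finite, simple and undirected; graphs need not be connected. Clusters. A graph (respectively, a finite simplicial complex) $X$ is a cluster of $X_1,\dots,X_k$, called its parts, if the $X_i$ are induced subgraphs (respectively, induced subcomplexes) of $X$, $X=X_1\cup\dots\cup X_k$, and for $i\neq j$ the intersection $X_i\cap X_j$ is empty or a single vertex. The shape of the cluster is the hypergraph with vertex set $V(X)$ and hyperedges $V(X_1),\dots,V(X_k)$. The cluster-girth is the smallest $l\ge 3$ for which there are pairwise distinct vertices $v_0,\dots,v_{l-1}$ and pairwise distinct indices $i_0,\dots,i_{l-1}$ with $v_j\in V(X_{i_{j-1}})\cap V(X_{i_j})$ for all $j$ modulo $l$; it is $\infty$ if there is no such $l$. Complexes. For a graph $G$, the clique complex $\mathrm{Cl}(G)$ is the simplicial complex on $V(G)$ whose faces are the cliques of $G$, and the closed neighbourhood complex $N[G]$ is the simplicial complex on $V(G)$ whose faces are the sets contained in $N_G[v]=\{v\}\cup\{w: vw\in E(G)\}$ for some vertex $v$. Proposition. Let a graph $G$ be a cluster of induced subgraphs $G_1,\dots,G_k$. For each $i$, regard $\mathrm{Cl}(G_i)$ and $N[G_i]$, formed in the graph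 $G_i$, as complexes with vertices in $V(G)$ through the inclusion $V(G_i)\subseteq V(G)$. (i) If the cluster-girth of $G$ is at least $4$, then $\mathrm{Cl}(G)$ is a cluster of $\mathrm{Cl}(G_1),\dots,\mathrm{Cl}(G_k)$, and this cluster has the same shape as the cluster $G$. (ii) If the cluster-girth of $G$ is at least $5$, then there is a simplicial complex $A$ with $V(A)=V(G)$ which is a cluster of $N[G_1],\dots,N[G_k]$ of the same shape as the cluster $G$ and such that $N[G]$ simplicially collapses to $A$ (by a finite sequence of elementary collapses); moreover, the geometric realizations of $N[G]$ and $A$ are homotopy equivalent. -/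

import Mathlib

namespace ClusterComplex

universe u

variable {V : Type u}

/-! ### Simplicial complexes

Abstract simplicial complexes with vertices among the elements of `V` are Mathlib's
`PreAbstractSimplicialComplex V`: down-closed families of nonempty finite sets. -/

/-- The vertex set of a complex. -/
def vertices (K : PreAbstractSimplicialComplex V) : Set V :=
  {v | {v} ∈ K.faces}

/-- `L` is an induced subcomplex of `K`: a subcomplex that contains every face of `K` all of whose
vertices are vertices of `L`. -/
def IsInducedSubcomplex (L K : PreAbstractSimplicialComplex V) : Prop :=
  L ≤ K ∧ ∀ σ ∈ K.faces, (σ : Set V) ⊆ vertices L → σ ∈ L.faces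

/-- A complex whose vertices are the elements of a subset `S` of `V`, viewed as a complex with
vertices in `V` through the inclusion of `S` in `V`. -/
noncomputable def included {S : Set V} (K : PreAbstractSimplicialComplex S) :
    PreAbstractSimplicialComplex V :=
  letI := Classical.decEq V
  K.map Subtype.val

/-! ### Clique complex and closed neighbourhood complex -/

/-- The clique complex `Cl(G)`: the faces are the nonempty finite cliques of `G`. -/
def cliqueComplex (G : SimpleGraph V) : PreAbstractSimplicialComplex V where
  faces := {σ | σ.Nonempty ∧ G.IsClique (σ : Set V)}
  isRelLowerSet_faces := fun _ hσ =>
    ⟨hσ.1, fun _ hτ hne => ⟨hne, hσ.2.subset (Finset.coe_subset.2 hτ)⟩⟩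

/-- The closed neighbourhood `N_G[v]`. -/
def closedNeighborSet (G : SimpleGraph V) (v : V) : Set V :=
  insert v (G.neighborSet v)

/-- The closed neighbourhood complex `N[G]`: the faces are the nonempty finite sets contained in
some closed neighbourhood. -/
def closedNeighborComplex (G : SimpleGraph V) : PreAbstractSimplicialComplex V where
  faces := {σ | σ.Nonempty ∧ ∃ v, (σ : Set V) ⊆ closedNeighborSet G v}
  isRelLowerSet_faces := fun _ hσ =>
    ⟨hσ.1, fun _ hτ hne =>
      ⟨hne, hσ.2.imp fun _ hv => (Finset.coe_subset.2 hτ).trans hv⟩⟩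

/-! ### Clusters and their shapes -/

/-- `G` is a cluster of the induced subgraphs `P 0, …, P (k - 1)`: it is their union, and any two
of them with distinct indices share at most one vertex. -/
structure IsGraphCluster (G : SimpleGraph V) {k : ℕ} (P : Fin k → G.Subgraph) : Prop where
  induced : ∀ i, (P i).IsInduced
  union : ⨆ i, P i = ⊤
  inter : ∀ i j, i ≠ j → (P i ⊓ P j).verts.Subsingleton

/-- `K` is a cluster of the induced subcomplexes `P 0, …, P (k - 1)`: it is their union, and any
two of them with distinct indices share at most one vertex. -/
structure IsComplexCluster (K : PreAbstractSimplicialComplex V) {k : ℕ}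
    (P : Fin k → PreAbstractSimplicialComplex V) : Prop where
  induced : ∀ i, IsInducedSubcomplex (P i) K
  union : ⨆ i, P i = K
  inter : ∀ i j, i ≠ j → (vertices (P i ⊓ P j)).Subsingleton

/-- The shape of a cluster of graphs: the hypergraph on the vertices of the graph whose hyperedges
are the vertex sets of the parts. -/
def graphShape {G : SimpleGraph V} {k : ℕ} {P : Fin k → G.Subgraph}
    (_h : IsGraphCluster G P) : Hypergraph V where
  vertexSet := Set.univ
  edgeSet := Set.range fun i => (P i).verts
  subset_vertexSet_of_mem_edgeSet' := fun _ _ => Set.subset_univ _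

/-- The shape of a cluster of complexes: the hypergraph on the vertices of the complex whose
hyperedges are the vertex sets of the parts. -/
def complexShape {K : PreAbstractSimplicialComplex V} {k : ℕ}
    {P : Fin k → PreAbstractSimplicialComplex V} (h : IsComplexCluster K P) : Hypergraph V where
  vertexSet := vertices K
  edgeSet := Set.range fun i => vertices (P i)
  subset_vertexSet_of_mem_edgeSet' := by
    rintro _ ⟨i, rfl⟩ v hv
    exact (h.induced i).1 hv

/-- There is a cycle `v 0, P (p 0), v 1, P (p 1), …, v (l - 1), P (p (l - 1)), v 0` with distinct
vertices and distinct indices of parts, in which each vertex lies in the part before it and in the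
part after it (indices modulo `l`). -/
def HasClusterCycle {G : SimpleGraph V} {k : ℕ} (P : Fin k → G.Subgraph) (l : ℕ) : Prop :=
  ∃ (v : ZMod l → V) (p : ZMod l → Fin k), Function.Injective v ∧ Function.Injective p ∧
    ∀ j, v j ∈ (P (p (j - 1))).verts ∧ v j ∈ (P (p j)).verts

/-- The cluster-girth: the least length `l ≥ 3` of a cycle of parts, and `⊤` if there is none. -/
noncomputable def clusterGirth {G : SimpleGraph V} {k : ℕ} {P : Fin k → G.Subgraph}
    (_h : IsGraphCluster G P) : ℕ∞ :=
  ⨅ (l : ℕ) (_ : 3 ≤ l ∧ HasClusterCycle P l), (l : ℕ∞)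

/-! ### Collapses and geometric realization -/

/-- `L` arises from `K` by an elementary collapse: by removing a face `τ` together with a face
`σ` of codimension one in `τ`, where `τ` is the only face of `K` that properly contains `σ`. -/
def ElementaryCollapse (K L : PreAbstractSimplicialComplex V) : Prop :=
  ∃ σ ∈ K.faces, ∃ τ ∈ K.faces, σ ⊂ τ ∧ τ.card = σ.card + 1 ∧
    (∀ ρ ∈ K.faces, σ ⊂ ρ → ρ = τ) ∧ L.faces = K.faces \ {σ, τ}

/-- `K` simplicially collapses to `L`: a finite (possibly empty) sequence of elementary collapses
leads from `K` to `L`. -/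
def Collapses (K L : PreAbstractSimplicialComplex V) : Prop :=
  Relation.ReflTransGen ElementaryCollapse K L

/-- The geometric realization of a complex with vertices in a finite type: the points, given by
barycentric coordinates, of the standard simplex on `V` whose support is a face, with the topology
of a subspace of `ℝ^V`. -/
def realization [Fintype V] (K : PreAbstractSimplicialComplex V) : Set (V → ℝ) :=
  {x | x ∈ stdSimplex ℝ V ∧ ∃ σ ∈ K.faces, (σ : Set V) = Function.support x}

end ClusterComplex

/-!
The proof is local: everything takes place around a single vertex.

*Short cycles.* If the cluster-girth exceeds `3`, a triangle of vertices whose sides lie in parts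
lies in a single part (`eq_of_triangle`); if it exceeds `4`, any two consecutive sides of a square
lie in the same part (`eq_of_square`). The first fact puts every clique of `G` inside one part, which is (i).

*Spread sets.* For (ii), call a set of vertices spread at `v` if it contains neighbours of `v`
through two different parts. A face of `N[G]` is missing from the union `A` of the complexes `N[Gᵢ]`
exactly if it is spread at some vertex `v`, and by the two facts above `v` is then the only vertex
whose closed neighbourhood contains the face (`IsSpread.eq_of_subset`). Whether a set is spread at
`v` does not depend on whether it contains `v`. So the missing faces come in pairs
`σ \ {v}`, `σ ∪ {v}`, and when the pairs are removed in the order of decreasing size every removal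
is an elementary collapse (`collapses_of_apex`).

*Homotopy equivalence.* An elementary collapse removing `σ` and `τ = σ ∪ {p}` is realized by the
retraction that moves the mass `m = min {x s | s ∈ σ}` from every vertex of `σ` to `p`. It is the
identity off the removed open simplices, and on them it stays inside the simplex `τ`, so that the
straight line homotopy connects it to the identity (`ElementaryCollapse.homotopyEquiv`).
-/

namespace ClusterComplex

universe u

variable {V : Type u}

/-! ### Short cycles of parts -/

section Cycles

variable {G : SimpleGraph V} {k : ℕ} {P : Fin k → G.Subgraph}

theorem not_hasClusterCycle_of_lt_clusterGirth (hP : IsGraphCluster G P) {l : ℕ} (hl : 3 ≤ l)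
    (h : (l + 1 : ℕ) ≤ clusterGirth hP) : ¬ HasClusterCycle P l := by
  intro hc
  have h1 : clusterGirth hP ≤ l := iInf₂_le l ⟨hl, hc⟩
  have h2 := h.trans h1
  norm_cast at h2
  omega

theorem IsGraphCluster.eq_of_mem (hP : IsGraphCluster G P) {a b : V} (hab : a ≠ b) {i j : Fin k}
    (hai : a ∈ (P i).verts) (hbi : b ∈ (P i).verts) (haj : a ∈ (P j).verts)
    (hbj : b ∈ (P j).verts) : i = j := by
  by_contra hij
  exact hab (hP.inter i j hij ⟨hai, haj⟩ ⟨hbi, hbj⟩)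

theorem IsGraphCluster.exists_mem (hP : IsGraphCluster G P) (v : V) : ∃ i, v ∈ (P i).verts := by
  have h : v ∈ (⨆ i, P i).verts := by rw [hP.union]; trivial
  rwa [SimpleGraph.Subgraph.verts_iSup, Set.mem_iUnion] at h

theorem IsGraphCluster.exists_adj (hP : IsGraphCluster G P) {a b : V} (h : G.Adj a b) :
    ∃ i, (P i).Adj a b := by
  have h : (⨆ i, P i).Adj a b := by rw [hP.union]; exact h
  rwa [SimpleGraph.Subgraph.iSup_adj] at h

theorem IsGraphCluster.eq_of_triangle (hP : IsGraphCluster G P) (h3 : ¬ HasClusterCycle P 3)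
    {a b c : V} (hab : a ≠ b) (hbc : b ≠ c) (hac : a ≠ c) {i j l : Fin k}
    (hai : a ∈ (P i).verts) (hbi : b ∈ (P i).verts) (hbj : b ∈ (P j).verts)
    (hcj : c ∈ (P j).verts) (hcl : c ∈ (P l).verts) (hal : a ∈ (P l).verts) :
    i = j ∧ j = l := by
  by_cases hij : i = j
  · subst hij
    exact ⟨rfl, hP.eq_of_mem hac hai hcj hal hcl⟩
  by_cases hjl : j = l
  · subst hjl
    exact ⟨hP.eq_of_mem hab hai hbi hal hbj, rfl⟩
  by_cases hil : i = l
  · subst hil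
    have := hP.eq_of_mem hbc hbi hcl hbj hcj
    exact ⟨this, this.symm⟩
  refine absurd ⟨(![a, b, c] : Fin 3 → V), (![i, j, l] : Fin 3 → Fin k), ?_, ?_, ?_⟩ h3
  · change Function.Injective (![a, b, c] : Fin 3 → V)
    intro x y
    fin_cases x <;> fin_cases y <;> simp [hab, hbc, hac, hab.symm, hbc.symm, hac.symm]
  · change Function.Injective (![i, j, l] : Fin 3 → Fin k)
    intro x y
    fin_cases x <;> fin_cases y <;> simp [hij, hjl, hil, Ne.symm hij, Ne.symm hjl, Ne.symm hil]
  · intro x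
    change Fin 3 at x
    fin_cases x
    exacts [⟨hal, hai⟩, ⟨hbi, hbj⟩, ⟨hcj, hcl⟩]

theorem IsGraphCluster.eq_of_square (hP : IsGraphCluster G P) (h3 : ¬ HasClusterCycle P 3)
    (h4 : ¬ HasClusterCycle P 4) {a b c d : V} (hab : a ≠ b) (hac : a ≠ c) (had : a ≠ d)
    (hbc : b ≠ c) (hbd : b ≠ d) (hcd : c ≠ d) {i j l m : Fin k}
    (hai : a ∈ (P i).verts) (hbi : b ∈ (P i).verts) (hbj : b ∈ (P j).verts)
    (hcj : c ∈ (P j).verts) (hcl : c ∈ (P l).verts) (hdl : d ∈ (P l).verts)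
    (hdm : d ∈ (P m).verts) (ham : a ∈ (P m).verts) : i = m := by
  by_cases hij : i = j
  · subst hij
    have := hP.eq_of_triangle h3 hac hcd had hai hcj hcl hdl hdm ham
    exact this.1.trans this.2
  by_cases hjl : j = l
  · subst hjl
    have := hP.eq_of_triangle h3 hab hbd had hai hbi hbj hdl hdm ham
    exact this.1.trans this.2
  by_cases hlm : l = m
  · subst hlm
    have := hP.eq_of_triangle h3 hab hbc hac hai hbi hbj hcj hcl ham
    exact this.1.trans this.2
  by_cases hil : i = l
  · subst hil
    exact hP.eq_of_mem had hai hdl ham hdm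
  by_cases hjm : j = m
  · subst hjm
    exact hP.eq_of_mem hab hai hbi ham hbj
  by_contra him
  refine h4 ⟨(![a, b, c, d] : Fin 4 → V), (![i, j, l, m] : Fin 4 → Fin k), ?_, ?_, ?_⟩
  · change Function.Injective (![a, b, c, d] : Fin 4 → V)
    intro x y
    fin_cases x <;> fin_cases y <;>
      simp [hab, hbc, hac, had, hbd, hcd, hab.symm, hbc.symm, hac.symm, had.symm, hbd.symm,
        hcd.symm]
  · change Function.Injective (![i, j, l, m] : Fin 4 → Fin k)
    intro x y
    fin_cases x <;> fin_cases y <;>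
      simp [hij, hjl, hil, hlm, hjm, him, Ne.symm hij, Ne.symm hjl, Ne.symm hil, Ne.symm hlm,
        Ne.symm hjm, Ne.symm him]
  · intro x
    change Fin 4 at x
    fin_cases x
    exacts [⟨ham, hai⟩, ⟨hbi, hbj⟩, ⟨hcj, hcl⟩, ⟨hdl, hdm⟩]

end Cycles

/-! ### The complexes of the parts -/

section Parts

variable {G : SimpleGraph V}

theorem mem_iSup_faces {ι : Type*} {K : ι → PreAbstractSimplicialComplex V} {σ : Finset V} :
    σ ∈ (⨆ i, K i).faces ↔ ∃ i, σ ∈ (K i).faces := by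
  change σ ∈ ⋃ L ∈ Set.range K, L.faces ↔ _
  simp

theorem mem_included_iff {S : Set V} {K : PreAbstractSimplicialComplex S} {σ : Finset V} :
    σ ∈ (included K).faces ↔
      ∃ τ ∈ K.faces, τ.map (Function.Embedding.subtype (· ∈ S)) = σ := by
  classical
  refine exists_congr fun τ => and_congr_right fun _ => ?_
  rw [Finset.map_eq_image]
  constructor <;> (rintro rfl; ext; simp)

theorem mem_included_cliqueComplex {H : G.Subgraph} {σ : Finset V} :
    σ ∈ (included (cliqueComplex H.coe)).faces ↔
      σ.Nonempty ∧ (σ : Set V) ⊆ H.verts ∧ (σ : Set V).Pairwise H.Adj := by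
  rw [mem_included_iff]
  constructor
  · rintro ⟨τ, ⟨hne, hτ⟩, rfl⟩
    refine ⟨hne.map, by simp, ?_⟩
    intro a ha b hb hab
    simp only [Finset.coe_map, Set.mem_image] at ha hb
    obtain ⟨x, hx, rfl⟩ := ha
    obtain ⟨y, hy, rfl⟩ := hb
    exact hτ hx hy fun h => hab (by rw [h])
  · rintro ⟨⟨a, ha⟩, hσ, hadj⟩
    classical
    refine ⟨σ.subtype (· ∈ H.verts), ⟨⟨⟨a, hσ ha⟩, by simpa using ha⟩, ?_⟩,
      Finset.subtype_map_of_mem hσ⟩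
    intro x hx y hy hxy
    exact hadj (by simpa using hx) (by simpa using hy) fun h => hxy (Subtype.ext h)

theorem mem_included_closedNeighborComplex {H : G.Subgraph} {σ : Finset V} :
    σ ∈ (included (closedNeighborComplex H.coe)).faces ↔
      σ.Nonempty ∧ ∃ v ∈ H.verts, ∀ a ∈ σ, a = v ∨ H.Adj v a := by
  rw [mem_included_iff]
  constructor
  · rintro ⟨τ, ⟨hne, v, hτ⟩, rfl⟩
    refine ⟨hne.map, v, v.2, ?_⟩
    intro a ha
    obtain ⟨x, hx, rfl⟩ := Finset.mem_map.1 ha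
    rcases hτ hx with h | h
    · exact Or.inl (by rw [h]; rfl)
    · exact Or.inr h
  · rintro ⟨⟨a, ha⟩, v, hv, h⟩
    have hσ : ∀ a ∈ σ, a ∈ H.verts := fun a ha => by
      rcases h a ha with rfl | h
      exacts [hv, h.snd_mem]
    classical
    refine ⟨σ.subtype (· ∈ H.verts), ⟨⟨⟨a, hσ a ha⟩, by simpa using ha⟩, ⟨v, hv⟩, ?_⟩,
      Finset.subtype_map_of_mem hσ⟩
    intro x hx
    rcases h x (by simpa using hx) with h | h
    exacts [Or.inl (Subtype.ext h), Or.inr h]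

theorem vertices_included_cliqueComplex (H : G.Subgraph) :
    vertices (included (cliqueComplex H.coe)) = H.verts := by
  ext v
  simp [vertices, mem_included_cliqueComplex]

theorem vertices_included_closedNeighborComplex (H : G.Subgraph) :
    vertices (included (closedNeighborComplex H.coe)) = H.verts := by
  ext v
  simp only [vertices, Set.mem_ofPred_eq, mem_included_closedNeighborComplex,
    Finset.singleton_nonempty, true_and, Finset.mem_singleton, forall_eq]
  constructor
  · rintro ⟨w, hw, rfl | h⟩
    exacts [hw, h.snd_mem]
  · exact fun h => ⟨v, h, Or.inl rfl⟩

theorem vertices_inf_subset (K L : PreAbstractSimplicialComplex V) :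
    vertices (K ⊓ L) ⊆ vertices K ∩ vertices L :=
  fun _ h => h

variable {k : ℕ} {P : Fin k → G.Subgraph}

/-- Complexes on the vertex sets of the parts of a graph cluster meet in at most one vertex. -/
theorem IsGraphCluster.vertices_inf_subsingleton (hP : IsGraphCluster G P)
    {Q : Fin k → PreAbstractSimplicialComplex V} (hQ : ∀ i, vertices (Q i) = (P i).verts)
    (i j : Fin k) (hij : i ≠ j) : (vertices (Q i ⊓ Q j)).Subsingleton := by
  refine (hP.inter i j hij).anti ((vertices_inf_subset _ _).trans ?_)
  rw [hQ, hQ]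
  exact subset_rfl

/-- A cluster of complexes on the vertex sets of the parts of a graph cluster has the same shape. -/
theorem complexShape_eq_graphShape (hP : IsGraphCluster G P) {K : PreAbstractSimplicialComplex V}
    {Q : Fin k → PreAbstractSimplicialComplex V} (h : IsComplexCluster K Q)
    (hQ : ∀ i, vertices (Q i) = (P i).verts) : complexShape h = graphShape hP := by
  apply Hypergraph.ext
  · refine Set.eq_univ_of_forall fun v => ?_
    obtain ⟨i, hi⟩ := hP.exists_mem v
    exact (h.induced i).1 (show v ∈ vertices (Q i) by rwa [hQ])
  · change Set.range (fun i => vertices (Q i)) = Set.range fun i => (P i).verts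
    simp_rw [hQ]

/-- Every clique lies in a single part: fix an edge of it; each further vertex closes a triangle. -/
theorem IsGraphCluster.exists_clique_subset (hP : IsGraphCluster G P)
    (h3 : ¬ HasClusterCycle P 3) {σ : Set V} (hne : σ.Nonempty) (hσ : G.IsClique σ) :
    ∃ i, σ ⊆ (P i).verts := by
  obtain ⟨a, ha⟩ := hne
  by_cases hs : σ ⊆ {a}
  · obtain ⟨i, hi⟩ := hP.exists_mem a
    exact ⟨i, hs.trans (Set.singleton_subset_iff.2 hi)⟩
  obtain ⟨b, hb, hba⟩ := Set.not_subset.1 hs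
  have hab : a ≠ b := Ne.symm hba
  obtain ⟨i, hi⟩ := hP.exists_adj (hσ ha hb hab)
  refine ⟨i, fun c hc => ?_⟩
  by_cases hac : a = c
  · exact hac ▸ hi.fst_mem
  by_cases hbc : b = c
  · exact hbc ▸ hi.snd_mem
  obtain ⟨j, hj⟩ := hP.exists_adj (hσ hb hc hbc)
  obtain ⟨l, hl⟩ := hP.exists_adj (hσ ha hc hac)
  have := (hP.eq_of_triangle h3 hab hbc hac hi.fst_mem hi.snd_mem hj.fst_mem hj.snd_mem
    hl.snd_mem hl.fst_mem).1
  exact this ▸ hj.snd_mem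

theorem IsGraphCluster.isComplexCluster_cliqueComplex (hP : IsGraphCluster G P)
    (h3 : ¬ HasClusterCycle P 3) :
    IsComplexCluster (cliqueComplex G) (fun i => included (cliqueComplex (P i).coe)) := by
  have hle : ∀ i, included (cliqueComplex (P i).coe) ≤ cliqueComplex G := fun i σ hσ => by
    obtain ⟨hne, -, h⟩ := mem_included_cliqueComplex.1 hσ
    exact ⟨hne, fun a ha b hb hab => (h ha hb hab).adj_sub⟩
  have hmem : ∀ i, ∀ σ ∈ (cliqueComplex G).faces, (σ : Set V) ⊆ (P i).verts →
      σ ∈ (included (cliqueComplex (P i).coe)).faces := fun i σ hσ hs =>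
    mem_included_cliqueComplex.2
      ⟨hσ.1, hs, fun a ha b hb hab => hP.induced i (hs ha) (hs hb) (hσ.2 ha hb hab)⟩
  refine ⟨fun i => ⟨hle i, fun σ hσ hs => hmem i σ hσ ?_⟩, le_antisymm (iSup_le hle) ?_,
    hP.vertices_inf_subsingleton fun i => vertices_included_cliqueComplex (P i)⟩
  · rwa [vertices_included_cliqueComplex] at hs
  · intro σ hσ
    obtain ⟨i, hi⟩ := hP.exists_clique_subset h3 (Finset.coe_nonempty.2 hσ.1) hσ.2
    exact mem_iSup_faces.2 ⟨i, hmem i σ hσ hi⟩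

theorem IsGraphCluster.isComplexCluster_iSup_closedNeighborComplex (hP : IsGraphCluster G P) :
    IsComplexCluster (⨆ i, included (closedNeighborComplex (P i).coe))
      (fun i => included (closedNeighborComplex (P i).coe)) := by
  refine ⟨fun i => ⟨le_iSup (fun i => included (closedNeighborComplex (P i).coe)) i, ?_⟩, rfl,
    hP.vertices_inf_subsingleton fun i => vertices_included_closedNeighborComplex (P i)⟩
  intro σ hσ hs
  rw [vertices_included_closedNeighborComplex] at hs
  obtain ⟨j, hj⟩ := mem_iSup_faces.1 hσ
  by_cases hij : i = j
  · exact hij ▸ hj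
  -- A face of another part all of whose vertices lie in `P i` is a single vertex.
  obtain ⟨hne, w, hw, h⟩ := mem_included_closedNeighborComplex.1 hj
  obtain ⟨a, ha⟩ := hne
  have hsj : ∀ b ∈ σ, b ∈ (P j).verts := fun b hb => by
    rcases h b hb with rfl | h
    exacts [hw, h.snd_mem]
  refine mem_included_closedNeighborComplex.2 ⟨⟨a, ha⟩, a, hs ha, fun b hb => Or.inl ?_⟩
  exact hP.inter i j hij ⟨hs hb, hsj b hb⟩ ⟨hs ha, hsj a ha⟩

end Parts

/-! ### Spread sets -/

section Spread

variable {G : SimpleGraph V} {k : ℕ} {P : Fin k → G.Subgraph}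

/-- A set of vertices is spread at `v` if it contains neighbours of `v` through two different
parts. Nothing is asked about `v` itself or about the other elements of the set. -/
def IsSpread (P : Fin k → G.Subgraph) (v : V) (σ : Finset V) : Prop :=
  ∃ a ∈ σ, ∃ b ∈ σ, ∃ i j, i ≠ j ∧ (P i).Adj v a ∧ (P j).Adj v b

theorem IsSpread.mono {v : V} {σ ρ : Finset V} (h : IsSpread P v σ) (hs : σ ⊆ ρ) :
    IsSpread P v ρ := by
  obtain ⟨a, ha, b, hb, h⟩ := h
  exact ⟨a, hs ha, b, hs hb, h⟩

theorem IsSpread.erase [DecidableEq V] {v : V} {σ : Finset V} (h : IsSpread P v σ) :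
    IsSpread P v (σ.erase v) := by
  obtain ⟨a, ha, b, hb, i, j, hij, hi, hj⟩ := h
  exact ⟨a, Finset.mem_erase.2 ⟨hi.ne.symm, ha⟩, b, Finset.mem_erase.2 ⟨hj.ne.symm, hb⟩, i, j,
    hij, hi, hj⟩

/-- A set spread at `v` lies in no closed neighbourhood other than that of `v`: neighbours `a`, `b`
of `v` through different parts that lie in `N[w]` form a triangle or a square with `v` and `w`. -/
theorem IsSpread.eq_of_subset (hP : IsGraphCluster G P) (h3 : ¬ HasClusterCycle P 3)
    (h4 : ¬ HasClusterCycle P 4) {v w : V} {σ : Finset V} (h : IsSpread P v σ)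
    (hw : (σ : Set V) ⊆ closedNeighborSet G w) : w = v := by
  obtain ⟨a, ha, b, hb, i, j, hij, hi, hj⟩ := h
  by_contra hwv
  have hab : a ≠ b := by
    rintro rfl
    exact hij (hP.eq_of_mem hi.ne hi.fst_mem hi.snd_mem hj.fst_mem hj.snd_mem)
  have hnadj : ¬ G.Adj a b := fun hadj => by
    obtain ⟨m, hm⟩ := hP.exists_adj hadj
    have := hP.eq_of_triangle h3 hi.ne hab hj.ne hi.fst_mem hi.snd_mem hm.fst_mem hm.snd_mem
      hj.snd_mem hj.fst_mem
    exact hij (this.1.trans this.2)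
  rcases hw ha with rfl | hwa
  · rcases hw hb with rfl | hwb
    exacts [hab rfl, hnadj hwb]
  rcases hw hb with rfl | hwb
  · exact hnadj (SimpleGraph.Adj.symm hwa)
  obtain ⟨m, hm⟩ := hP.exists_adj hwa
  obtain ⟨n, hn⟩ := hP.exists_adj hwb
  exact hij (hP.eq_of_square h3 h4 hi.ne (Ne.symm hwv) hj.ne hm.ne.symm hab hn.ne hi.fst_mem
    hi.snd_mem hm.snd_mem hm.fst_mem hn.fst_mem hn.snd_mem hj.snd_mem hj.fst_mem)

theorem iSup_included_le_closedNeighborComplex :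
    ⨆ i, included (closedNeighborComplex (P i).coe) ≤ closedNeighborComplex G := by
  refine iSup_le fun i σ hσ => ?_
  obtain ⟨hne, v, -, h⟩ := mem_included_closedNeighborComplex.1 hσ
  exact ⟨hne, v, fun a ha => (h a ha).imp_right fun h => h.adj_sub⟩

theorem IsGraphCluster.isSpread_of_notMem (hP : IsGraphCluster G P) {v : V} {σ : Finset V}
    (hne : σ.Nonempty) (hv : (σ : Set V) ⊆ closedNeighborSet G v)
    (hσ : σ ∉ (⨆ i, included (closedNeighborComplex (P i).coe)).faces) : IsSpread P v σ := by
  by_contra hs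
  apply hσ
  rw [mem_iSup_faces]
  by_cases h : ∃ a ∈ σ, G.Adj v a
  · obtain ⟨a, ha, hva⟩ := h
    obtain ⟨i, hi⟩ := hP.exists_adj hva
    refine ⟨i, mem_included_closedNeighborComplex.2 ⟨hne, v, hi.fst_mem, fun b hb => ?_⟩⟩
    refine (hv hb).imp_right fun hvb => ?_
    obtain ⟨j, hj⟩ := hP.exists_adj hvb
    by_cases hij : i = j
    · exact hij ▸ hj
    · exact absurd ⟨a, ha, b, hb, i, j, hij, hi, hj⟩ hs
  · obtain ⟨i, hi⟩ := hP.exists_mem v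
    refine ⟨i, mem_included_closedNeighborComplex.2 ⟨hne, v, hi, fun b hb => Or.inl ?_⟩⟩
    exact (hv hb).resolve_right fun hvb => h ⟨b, hb, hvb⟩

theorem IsSpread.notMem (hP : IsGraphCluster G P) (h3 : ¬ HasClusterCycle P 3)
    (h4 : ¬ HasClusterCycle P 4) {v : V} {σ : Finset V} (h : IsSpread P v σ) :
    σ ∉ (⨆ i, included (closedNeighborComplex (P i).coe)).faces := by
  intro hσ
  obtain ⟨m, hm⟩ := mem_iSup_faces.1 hσ
  obtain ⟨-, w, -, hw⟩ := mem_included_closedNeighborComplex.1 hm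
  obtain rfl := h.eq_of_subset hP h3 h4 (w := w) fun a ha =>
    (hw a ha).imp_right fun h => h.adj_sub
  obtain ⟨a, ha, b, hb, i, j, hij, hi, hj⟩ := h
  have hma := (hw a ha).resolve_left hi.ne.symm
  have hmb := (hw b hb).resolve_left hj.ne.symm
  exact hij ((hP.eq_of_mem hi.ne hi.fst_mem hi.snd_mem hma.fst_mem hma.snd_mem).trans
    (hP.eq_of_mem hj.ne hmb.fst_mem hmb.snd_mem hj.fst_mem hj.snd_mem))

end Spread

/-! ### Collapses -/

section Collapse

theorem mem_faces_of_subset {K : PreAbstractSimplicialComplex V} {σ ρ : Finset V}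
    (hρ : ρ ∈ K.faces) (hs : σ ⊆ ρ) (hne : σ.Nonempty) : σ ∈ K.faces :=
  (K.isRelLowerSet_faces hρ).2 hs hne

theorem nonempty_of_mem_faces {K : PreAbstractSimplicialComplex V} {σ : Finset V}
    (hσ : σ ∈ K.faces) : σ.Nonempty :=
  (K.isRelLowerSet_faces hσ).1

/-- The complex that remains when a free face `σ` is removed together with the only face `τ`
that properly contains it. -/
def removeFreePair (K : PreAbstractSimplicialComplex V) {σ τ : Finset V} (hστ : σ ⊂ τ)
    (hfree : ∀ ρ ∈ K.faces, σ ⊂ ρ → ρ = τ) : PreAbstractSimplicialComplex V where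
  faces := K.faces \ {σ, τ}
  isRelLowerSet_faces := by
    rintro ρ ⟨hρ, hρn⟩
    simp only [Set.mem_insert_iff, Set.mem_singleton_iff, not_or] at hρn
    refine ⟨nonempty_of_mem_faces hρ, fun π hπ hne => ⟨mem_faces_of_subset hρ hπ hne, ?_⟩⟩
    rintro (rfl | rfl)
    · exact hρn.2 (hfree ρ hρ (hπ.ssubset_of_ne (Ne.symm hρn.1)))
    · exact hρn.2 (hfree ρ hρ (hστ.trans_subset hπ))

/-- If every face `σ` of `K` outside the subcomplex `L` has an apex `c σ`, the same for all larger
faces, that can be added to `σ` and taken away from it without entering `L` or leaving `K`, then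
`K` collapses to `L`. -/
theorem collapses_of_apex [Finite V] [DecidableEq V] {K L : PreAbstractSimplicialComplex V}
    (hLK : L ≤ K) (c : Finset V → V)
    (hinsert : ∀ σ ∈ K.faces, σ ∉ L.faces → insert (c σ) σ ∈ K.faces)
    (herase : ∀ σ ∈ K.faces, σ ∉ L.faces →
      σ.erase (c σ) ∈ K.faces ∧ σ.erase (c σ) ∉ L.faces)
    (hc : ∀ σ ∈ K.faces, σ ∉ L.faces → ∀ ρ ∈ K.faces, σ ⊆ ρ → c ρ = c σ) :
    Collapses K L := by
  induction hn : (K.faces \ L.faces).ncard using Nat.strong_induction_on generalizing K with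
  | _ n ih =>
  rcases (K.faces \ L.faces).eq_empty_or_nonempty with hemp | hnonemp
  · obtain rfl : K = L := le_antisymm (Set.sdiff_eq_empty.1 hemp) hLK
    exact Relation.ReflTransGen.refl
  -- Remove first a missing face `τ` of maximal size; it contains its apex `c τ`.
  obtain ⟨τ, ⟨hτK, hτL⟩, hmax⟩ :=
    (Set.toFinite (K.faces \ L.faces)).exists_maximalFor Finset.card _ hnonemp
  have hup : ∀ {σ ρ : Finset V}, σ ∈ K.faces → σ ∉ L.faces → σ ⊆ ρ → ρ ∉ L.faces :=
    fun hσ hσL hs hρ => hσL (mem_faces_of_subset hρ hs (nonempty_of_mem_faces hσ))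
  have heq : ∀ {ρ : Finset V}, ρ ∈ K.faces → τ ⊆ ρ → ρ = τ := fun {ρ} hρ hs =>
    (Finset.eq_of_subset_of_card_le hs
      (hmax ⟨hρ, hup hτK hτL hs⟩ (Finset.card_le_card hs))).symm
  have hpτ : c τ ∈ τ := by
    rw [← Finset.insert_eq_self]
    exact heq (hinsert τ hτK hτL) (Finset.subset_insert _ _)
  obtain ⟨hσK, hσL⟩ := herase τ hτK hτL
  have hστ : τ.erase (c τ) ⊂ τ := Finset.erase_ssubset hpτ
  have hcσ : c τ = c (τ.erase (c τ)) := hc _ hσK hσL τ hτK hστ.subset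
  have hfree : ∀ ρ ∈ K.faces, τ.erase (c τ) ⊂ ρ → ρ = τ := by
    intro ρ hρ hs
    have hcρ : c ρ = c τ := (hc _ hσK hσL ρ hρ hs.subset).trans hcσ.symm
    have h1 : insert (c ρ) ρ = τ := by
      refine heq (hinsert ρ hρ (hup hσK hσL hs.subset)) ?_
      rw [hcρ]
      exact (Finset.insert_erase hpτ).symm.subset.trans (Finset.insert_subset_insert _ hs.subset)
    have h2 : ρ ⊆ τ := h1 ▸ Finset.subset_insert _ _
    refine Finset.eq_of_subset_of_card_le h2 ?_
    have := Finset.card_lt_card hs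
    rw [Finset.card_erase_of_mem hpτ] at this
    omega
  refine Relation.ReflTransGen.head (b := removeFreePair K hστ hfree)
    ⟨_, hσK, τ, hτK, hστ, (Finset.card_erase_add_one hpτ).symm, hfree, rfl⟩ ?_
  have hsub : (removeFreePair K hστ hfree).faces ⊆ K.faces := Set.sdiff_subset
  refine ih _ ?_ ?_ ?_ ?_ ?_ rfl
  · rw [← hn]
    refine Set.ncard_lt_ncard ⟨Set.sdiff_subset_sdiff_left hsub, fun h => ?_⟩ (Set.toFinite _)
    exact (h ⟨hτK, hτL⟩).1.2 (Or.inr rfl)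
  · intro ρ hρ
    refine ⟨hLK hρ, ?_⟩
    rintro (rfl | rfl)
    exacts [hσL hρ, hτL hρ]
  · rintro ρ ⟨hρ, hρn⟩ hρL
    refine ⟨hinsert ρ hρ hρL, ?_⟩
    have hcρ := hc ρ hρ hρL _ (hinsert ρ hρ hρL) (Finset.subset_insert _ _)
    have hmem := Finset.mem_insert_self (c ρ) ρ
    rintro (h | h)
    · rw [h] at hcρ hmem
      rw [← hcρ, ← hcσ] at hmem
      exact Finset.notMem_erase _ _ hmem
    · rw [h] at hcρ
      by_cases hm : c ρ ∈ ρ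
      · rw [Finset.insert_eq_self.2 hm] at h
        exact hρn (Or.inr h)
      · refine hρn (Or.inl ?_)
        rw [hcρ, ← h, Finset.erase_insert hm]
  · rintro ρ ⟨hρ, hρn⟩ hρL
    refine ⟨⟨(herase ρ hρ hρL).1, ?_⟩, (herase ρ hρ hρL).2⟩
    have hs := Finset.erase_subset (c ρ) ρ
    rintro (h | h)
    · rw [h] at hs
      by_cases he : τ.erase (c τ) = ρ
      · exact hρn (Or.inl he.symm)
      · exact hρn (Or.inr (hfree ρ hρ (hs.ssubset_of_ne he)))
    · rw [h] at hs
      exact hρn (Or.inr (heq hρ hs))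
  · exact fun σ hσ hσL ρ hρ hs => hc σ (hsub hσ) hσL ρ (hsub hρ) hs

theorem IsGraphCluster.collapses_closedNeighborComplex [Finite V] {G : SimpleGraph V} {k : ℕ}
    {P : Fin k → G.Subgraph} (hP : IsGraphCluster G P) (h3 : ¬ HasClusterCycle P 3)
    (h4 : ¬ HasClusterCycle P 4) :
    Collapses (closedNeighborComplex G) (⨆ i, included (closedNeighborComplex (P i).coe)) := by
  classical
  rcases isEmpty_or_nonempty V with hV | hV
  · have : closedNeighborComplex G = ⨆ i, included (closedNeighborComplex (P i).coe) :=
      le_antisymm (fun σ hσ => (hV.false hσ.1.choose).elim)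
        iSup_included_le_closedNeighborComplex
    rw [← this]
    exact Relation.ReflTransGen.refl
  have hex : ∀ σ : Finset V, ∃ v, σ ∈ (closedNeighborComplex G).faces →
      (σ : Set V) ⊆ closedNeighborSet G v := fun σ => by
    by_cases hσ : σ ∈ (closedNeighborComplex G).faces
    · exact hσ.2.imp fun v hv _ => hv
    · exact ⟨hV.some, fun h => absurd h hσ⟩
  choose c hc using hex
  have hspread : ∀ σ ∈ (closedNeighborComplex G).faces,
      σ ∉ (⨆ i, included (closedNeighborComplex (P i).coe)).faces → IsSpread P (c σ) σ :=
    fun σ hσ hσL => hP.isSpread_of_notMem hσ.1 (hc σ hσ) hσL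
  refine collapses_of_apex iSup_included_le_closedNeighborComplex c ?_ ?_ ?_
  · intro σ hσ _
    refine ⟨Finset.insert_nonempty _ _, c σ, ?_⟩
    rw [Finset.coe_insert]
    exact Set.insert_subset (Set.mem_insert _ _) (hc σ hσ)
  · intro σ hσ hσL
    have hs := (hspread σ hσ hσL).erase
    exact ⟨mem_faces_of_subset hσ (Finset.erase_subset _ _) (hs.imp fun _ h => h.1),
      hs.notMem hP h3 h4⟩
  · intro σ hσ hσL ρ hρ hs
    exact (hspread σ hσ hσL).eq_of_subset hP h3 h4
      ((Finset.coe_subset.2 hs).trans (hc ρ hρ))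

end Collapse

/-! ### The homotopy equivalence of a collapse -/

section PushOff

/-- Move the least coordinate over `σ` from every vertex of `σ` to the vertex `p`. -/
noncomputable def pushOff [DecidableEq V] (σ : Finset V) (hσ : σ.Nonempty) (p : V) (x : V → ℝ) :
    V → ℝ :=
  fun v => x v - (if v ∈ σ then σ.inf' hσ x else 0) +
    (if v = p then σ.card * σ.inf' hσ x else 0)

variable [DecidableEq V] {σ : Finset V} {hσ : σ.Nonempty} {p : V} {x : V → ℝ}

theorem continuous_pushOff : Continuous (pushOff σ hσ p) := by
  have h : Continuous fun x : V → ℝ => σ.inf' hσ x :=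
    Continuous.finset_inf'_apply hσ fun i _ => continuous_apply i
  refine continuous_pi fun v => ?_
  unfold pushOff
  split_ifs <;> fun_prop

theorem pushOff_eq_self (h : σ.inf' hσ x = 0) : pushOff σ hσ p x = x := by
  ext v
  simp [pushOff, h]

theorem pushOff_eq_zero {v : V} (hv : v ∉ insert p σ) (hx : x v = 0) :
    pushOff σ hσ p x v = 0 := by
  rw [Finset.mem_insert, not_or] at hv
  simp [pushOff, hv.1, hv.2, hx]

/-- Pushing off makes a coordinate over `σ` vanish. -/
theorem exists_pushOff_eq_zero (hp : p ∉ σ) : ∃ v ∈ σ, pushOff σ hσ p x v = 0 := by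
  obtain ⟨v, hv, hvm⟩ := Finset.exists_mem_eq_inf' hσ x
  refine ⟨v, hv, ?_⟩
  have : v ≠ p := fun h => hp (h ▸ hv)
  simp [pushOff, hv, this, ← hvm]

theorem pushOff_mem_stdSimplex [Fintype V] (hx : x ∈ stdSimplex ℝ V) :
    pushOff σ hσ p x ∈ stdSimplex ℝ V := by
  have hm : 0 ≤ σ.inf' hσ x := (Finset.le_inf'_iff hσ _).2 fun v _ => hx.1 v
  constructor
  · intro v
    have h1 : 0 ≤ x v - (if v ∈ σ then σ.inf' hσ x else 0) := by
      split_ifs with hv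
      · exact sub_nonneg.2 (Finset.inf'_le _ hv)
      · simpa using hx.1 v
    have h2 : 0 ≤ (if v = p then σ.card * σ.inf' hσ x else 0) := by
      split_ifs <;> positivity
    exact add_nonneg h1 h2
  · simp [pushOff, Finset.sum_add_distrib, Finset.sum_sub_distrib, hx.2]

end PushOff

section Realization

variable [Fintype V] {K L : PreAbstractSimplicialComplex V}

/-- A point of the standard simplex whose support lies in a face is a point of the realization. -/
theorem mem_realization_of_support_subset {x : V → ℝ}
    (hx : x ∈ stdSimplex ℝ V) {τ : Finset V} (hτ : τ ∈ K.faces) (hs : ∀ v ∉ τ, x v = 0) :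
    x ∈ realization K := by
  classical
  refine ⟨hx, Finset.univ.filter (x · ≠ 0), ?_, by ext; simp⟩
  refine mem_faces_of_subset hτ (fun v hv => ?_) ?_
  · by_contra h
    exact (Finset.mem_filter.1 hv).2 (hs v h)
  · by_contra h
    rw [Finset.not_nonempty_iff_eq_empty, Finset.filter_eq_empty_iff] at h
    have h0 : ∑ v, x v = 0 := Finset.sum_eq_zero fun v hv => not_not.1 (h hv)
    rw [hx.2] at h0
    exact one_ne_zero h0

/-- The least coordinate over `σ` is nonzero only at points whose support contains `σ`. -/
theorem subset_of_inf'_ne_zero {σ : Finset V} {hσ : σ.Nonempty} {x : V → ℝ}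
    {ρ : Finset V} (hρ : (ρ : Set V) = Function.support x)
    (hx : x ∈ stdSimplex ℝ V) (h : σ.inf' hσ x ≠ 0) : σ ⊆ ρ := by
  intro v hv
  rw [← Finset.mem_coe, hρ, Function.mem_support]
  intro h0
  exact h (le_antisymm (h0 ▸ Finset.inf'_le x hv) ((Finset.le_inf'_iff hσ _).2 fun v _ => hx.1 v))

theorem ElementaryCollapse.homotopyEquiv (h : ElementaryCollapse K L) :
    Nonempty (ContinuousMap.HomotopyEquiv (realization K) (realization L)) := by
  classical
  obtain ⟨σ, hσK, τ, hτK, hστ, hcard, hfree, hL⟩ := h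
  have hσ := nonempty_of_mem_faces hσK
  obtain ⟨p, hp, rfl⟩ : ∃ p ∉ σ, insert p σ = τ := by
    obtain ⟨p, hp, h⟩ := Finset.ssubset_iff.1 hστ
    exact ⟨p, hp, Finset.eq_of_subset_of_card_le h (by rw [Finset.card_insert_of_notMem hp, hcard])⟩
  have hLK : L.faces ⊆ K.faces := hL ▸ Set.sdiff_subset
  -- A point of `K` is fixed, or lies in the closed simplex of the face `insert p σ`.
  have hcases : ∀ x ∈ realization K,
      (pushOff σ hσ p x = x ∧ x ∈ realization L) ∨ ∀ v ∉ insert p σ, x v = 0 := by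
    rintro x ⟨hx, ρ, hρK, hρ⟩
    by_cases hs : σ ⊆ ρ
    · right
      have hρτ : ρ ⊆ insert p σ := by
        rcases eq_or_ne σ ρ with rfl | hne
        · exact Finset.subset_insert _ _
        · exact (hfree ρ hρK (hs.ssubset_of_ne hne)).subset
      intro v hv
      by_contra h0
      exact hv (hρτ (by rwa [← Finset.mem_coe, hρ]))
    · left
      refine ⟨pushOff_eq_self (by_contra fun h => hs (subset_of_inf'_ne_zero hρ hx h)), hx, ρ, ?_,
        hρ⟩
      rw [hL]
      refine ⟨hρK, ?_⟩
      rintro (rfl | rfl)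
      exacts [hs subset_rfl, hs hστ.subset]
  have hmapsL : ∀ x ∈ realization K, pushOff σ hσ p x ∈ realization L := by
    intro x hx
    rcases hcases x hx with ⟨h, hxL⟩ | h
    · rwa [h]
    have hr := pushOff_mem_stdSimplex (σ := σ) (hσ := hσ) (p := p) hx.1
    obtain ⟨-, ρ, hρK, hρ⟩ := mem_realization_of_support_subset hr hτK
      fun v hv => pushOff_eq_zero hv (h v hv)
    refine ⟨hr, ρ, ?_, hρ⟩
    obtain ⟨v, hv, hv0⟩ := exists_pushOff_eq_zero (hσ := hσ) (x := x) hp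
    have hvρ : v ∉ ρ := fun h => by
      rw [← Finset.mem_coe, hρ] at h
      exact h hv0
    rw [hL]
    refine ⟨hρK, ?_⟩
    rintro (rfl | rfl)
    exacts [hvρ hv, hvρ (Finset.mem_insert_of_mem hv)]
  have hincl : ∀ x ∈ realization L, x ∈ realization K := by
    rintro x ⟨hx, ρ, hρ, h⟩
    exact ⟨hx, ρ, hLK hρ, h⟩
  have hline : ∀ t : unitInterval, ∀ x ∈ realization K,
      (1 - (t : ℝ)) • pushOff σ hσ p x + (t : ℝ) • x ∈ realization K := by
    intro t x hx
    rcases hcases x hx with ⟨h, -⟩ | h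
    · rwa [h, ← add_smul, sub_add_cancel, one_smul]
    refine mem_realization_of_support_subset ?_ hτK fun v hv => ?_
    · exact convex_stdSimplex ℝ V (pushOff_mem_stdSimplex hx.1) hx.1 (sub_nonneg.2 t.2.2) t.2.1
        (sub_add_cancel _ _)
    · simp [h v hv, pushOff_eq_zero hv (h v hv)]
  let r : C(realization K, realization L) :=
    ⟨fun x => ⟨pushOff σ hσ p x, hmapsL x x.2⟩,
      (continuous_pushOff.comp continuous_subtype_val).subtype_mk _⟩
  let i : C(realization L, realization K) :=
    ⟨fun x => ⟨x, hincl x x.2⟩, continuous_subtype_val.subtype_mk _⟩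
  refine ⟨⟨r, i, ⟨⟨⟨fun q => ⟨_, hline q.1 q.2 q.2.2⟩, ?_⟩, ?_, ?_⟩⟩, ?_⟩⟩
  · have := continuous_pushOff (σ := σ) (hσ := hσ) (p := p)
    exact Continuous.subtype_mk (by fun_prop) _
  · intro x
    apply Subtype.ext
    simp [r, i]
  · intro x
    apply Subtype.ext
    simp
  · have : r.comp i = ContinuousMap.id _ := by
      ext1 x
      apply Subtype.ext
      change pushOff σ hσ p x.1 = x.1
      obtain ⟨x, hx, ρ, hρL, hρ⟩ := x
      refine pushOff_eq_self (by_contra fun h => ?_)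
      have hs := subset_of_inf'_ne_zero hρ hx h
      rw [hL] at hρL
      refine hρL.2 ?_
      rcases eq_or_ne σ ρ with rfl | hne
      · exact Or.inl rfl
      · exact Or.inr (hfree ρ hρL.1 (hs.ssubset_of_ne hne))
    rw [this]

theorem Collapses.homotopyEquiv (h : Collapses K L) :
    Nonempty (ContinuousMap.HomotopyEquiv (realization K) (realization L)) := by
  induction h with
  | refl => exact ⟨ContinuousMap.HomotopyEquiv.refl _⟩
  | tail _ h ih => exact ⟨ih.some.trans h.homotopyEquiv.some⟩

end Realization

end ClusterComplex

theorem mainTheorem4 {V : Type*} [Fintype V] (G : SimpleGraph V) (k : ℕ)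
    (P : Fin k → G.Subgraph) (hP : ClusterComplex.IsGraphCluster G P) :
    (4 ≤ ClusterComplex.clusterGirth hP →
      ∃ h : ClusterComplex.IsComplexCluster (ClusterComplex.cliqueComplex G)
          (fun i => ClusterComplex.included (ClusterComplex.cliqueComplex (P i).coe)),
        ClusterComplex.complexShape h = ClusterComplex.graphShape hP) ∧
    (5 ≤ ClusterComplex.clusterGirth hP →
      ∃ (A : PreAbstractSimplicialComplex V)
        (h : ClusterComplex.IsComplexCluster A
          (fun i => ClusterComplex.included (ClusterComplex.closedNeighborComplex (P i).coe))),
        ClusterComplex.complexShape h = ClusterComplex.graphShape hP ∧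
        ClusterComplex.Collapses (ClusterComplex.closedNeighborComplex G) A ∧
        Nonempty (ContinuousMap.HomotopyEquiv
          (ClusterComplex.realization (ClusterComplex.closedNeighborComplex G))
          (ClusterComplex.realization A))) := by
  open ClusterComplex in
  refine ⟨fun hg => ?_, fun hg => ?_⟩
  · have h3 := not_hasClusterCycle_of_lt_clusterGirth hP (l := 3) le_rfl (by exact_mod_cast hg)
    exact ⟨hP.isComplexCluster_cliqueComplex h3, complexShape_eq_graphShape hP _
      fun i => vertices_included_cliqueComplex (P i)⟩
  · have h4 := not_hasClusterCycle_of_lt_clusterGirth hP (l := 4) (by norm_num)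
      (by exact_mod_cast hg)
    have h3 := not_hasClusterCycle_of_lt_clusterGirth hP (l := 3) le_rfl
      (le_trans (by norm_num) hg)
    have hcol := hP.collapses_closedNeighborComplex h3 h4
    exact ⟨_, hP.isComplexCluster_iSup_closedNeighborComplex, complexShape_eq_graphShape hP _
      fun i => vertices_included_closedNeighborComplex (P i), hcol, hcol.homotopyEquiv⟩
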